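/- A cylindric partition with profile $c=(2,1)$ is a pair $\Lambda=(\lambda,\mu)$ of (possibly empty) integer partitions $\lambda=(\lambda_1\ge\lambda_2\ge\cdots)$ and $\mu=(\mu_1\ge\mu_2\ge\cdots)$, each padded with infinitely many zeros, such that $$\lambda_j\ge \mu_{j+1}\quad\text{and}\quad \mu_j\ge\lambda_{j+2}\qquad\text{for all } j\ge 1.$$ Its size $|\Lambda|$ is the sum of all parts of $\lambda$ and $\mu$. Let $(a;q)_n=\prod_{k=1}^{n}(1-aq^{k-1})$ and $(a;q)_\infty=\lim_{n\to\infty}(a;q)_n$. Theorem. Let $P_{(2,1)}$ be the set of all cylindric partitions with profile $(2,1)$. For every complex number $q$ with $|q|<1$, the series $\sum_{\Lambda\in P_{(2,1)}}q^{|\Lambda|}$ and $\sum_{n\ge0}q^{n^2}/(q^4;q^4)_n$ converge absolutely, the infinite products $(-q^2;q^2)_\infty$ and $(q;q)_\infty$ converge, the denominators $(q;q)_\infty$ and $(q^4;q^4)_n$ ($n\ge 0$) are nonzero, and $$\sum_{\Lambda\in P_{(2,1)}}q^{|\Lambda|}=\left(\sum_{n\ge 0}\frac{q^{n^2}}{(q^4;q^4)_n}\right)\cdot\frac{(-q^2;q^2)_\infty}{(q;q)_\infty}.$$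 -/

import Mathlib

open Filter Topology

/-- A cylindric partition of rank `r` with profile `c = (c 0, …, c (r - 1))`: a vector of `r`
ordinary partitions `parts 0, …, parts (r - 1)` with
`parts i j ≥ parts (i + 1) (j + c (i + 1))` for all `i` and `j`, where the index `i + 1` is read
cyclically, so that the last partition is compared with the first one.

An ordinary partition is written as a non-increasing sequence of natural numbers that is padded
by zeros (finitely many nonzero entries); its parts are the nonzero entries. Rows and positions
are numbered from `0`. -/
@[ext]
structure CylindricPartition {r : ℕ} [NeZero r] (c : Fin r → ℕ) where
  /-- `parts i j` is the `j`-th part of the `i`-th partition, or `0` if there is none. -/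
  parts : Fin r → ℕ →₀ ℕ
  antitone : ∀ i, Antitone (parts i)
  cylindric : ∀ (i : Fin r) (j : ℕ), parts (i + 1) (j + c (i + 1)) ≤ parts i j

/-- The size of a cylindric partition: the sum of all the parts of all its partitions. -/
def CylindricPartition.size {r : ℕ} [NeZero r] {c : Fin r → ℕ} (Λ : CylindricPartition c) : ℕ :=
  ∑ i, (Λ.parts i).sum fun _ p => p

/-- The finite `q`-Pochhammer symbol `(a; q)_n = (1 - a) (1 - a q) ⋯ (1 - a q ^ (n - 1))`. -/
def qPochhammer (a q : ℂ) (n : ℕ) : ℂ :=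
  ∏ k ∈ Finset.range n, (1 - a * q ^ k)

/-- The infinite `q`-Pochhammer symbol `(a; q)_∞ = lim (a; q)_n`. -/
noncomputable def qPochhammerInf (a q : ℂ) : ℂ :=
  limUnder atTop fun n => qPochhammer a q n

/-!
Interleave the rows `λ` and `μ` of a cylindric partition of profile `(2, 1)` into the sequence
`λ₁, μ₁, λ₂, μ₂, …`. The defining inequalities say exactly that each entry is at least as large as
every later entry except possibly the next one (`NearlyAntitone`). No two ascents of such a sequence
are adjacent, and exchanging the two entries at every ascent sorts it. The sorted sequence drops
strictly at every exchanged pair; its conjugate is therefore a partition containing the part `s + 1`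
for every exchanged pair `(s, s + 1)`. Removing one copy of each of these parts leaves an arbitrary
partition, while the removed parts form a partition with differences at least two. The size is
preserved (`SparseSet.merge_injective`, `SparseSet.exists_merge_eq`, `SparseSet.degree_merge`), so
the generating function is the product of those of the two kinds of partitions.

The generating function of all partitions is `1 / (q; q)_∞`: multiplied by `(q; q)_n` it counts the
partitions with all parts larger than `n`, which tends to `1`
(`tsum_pow_partSize_ne_zero_and_tendsto`). This also shows that `(q; q)_n` converges to a nonzero
limit. The partitions with differences at least two and `n` parts have generating function
`q ^ n ^ 2 / (q; q)_n`, by the recurrence that comes from lowering all parts by one or by two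
(`SparseSet.hasSum_pow_size`).

What remains is Rogers' identity
`∑ q ^ n ^ 2 / (q; q)_n = (-q²; q²)_∞ ∑ q ^ n ^ 2 / (q⁴; q⁴)_n`
(`tsum_pow_sq_div_qPochhammer_mul_eulerSeries`). On the right,
`(-q²; q²)_∞ / (q⁴; q⁴)_n = (-q ^ (2 * n + 2); q²)_∞ / (q²; q²)_n`, and Euler's series for the
numerator gives `∑ q ^ ((n + m) ^ 2 + m) / ((q²; q²)_n (q²; q²)_m)`. The terms with `n + m = N` are
summed by comparing coefficients in `1 / ((z; q²)_∞ (z q; q²)_∞) = 1 / (z; q)_∞`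
(`sum_antidiagonal_pow_mul_inv_qPochhammer`).
-/

/-! ### The product `(q; q)_∞` and partitions -/

theorem tsum_eq_add_of_bijective_sumElim {α β γ : Type*} {i : α → γ} {j : β → γ}
    (hij : Function.Bijective (Sum.elim i j)) {f : γ → ℂ} (hf : Summable f) :
    ∑' c, f c = ∑' a, f (i a) + ∑' b, f (j b) := by
  have hf' : Summable (f ∘ Sum.elim i j) := hf.comp_injective hij.1
  rw [← (Equiv.ofBijective _ hij).tsum_eq f]
  exact Summable.tsum_sum (f := f ∘ Sum.elim i j) (hf'.comp_injective Sum.inl_injective)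
    (hf'.comp_injective Sum.inr_injective)

/-- The size of the partition in which the part `s + 1` occurs `m s` times. -/
noncomputable def partSize : (ℕ →₀ ℕ) →+ ℕ := Finsupp.weight fun s => s + 1

theorem partSize_eq_sum (m : ℕ →₀ ℕ) : partSize m = m.sum fun s k => k * (s + 1) := by
  simp [partSize, Finsupp.weight_apply]

@[simp]
theorem partSize_single (s k : ℕ) : partSize (Finsupp.single s k) = k * (s + 1) := by
  simp [partSize_eq_sum]

theorem partSize_mapDomain_succ (m : ℕ →₀ ℕ) :
    partSize (m.mapDomain Nat.succ) = partSize m + m.degree := by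
  rw [partSize_eq_sum, partSize_eq_sum, Finsupp.degree_apply,
    Finsupp.sum_mapDomain_index_inj Nat.succ_injective, Finsupp.sum, Finsupp.sum,
    ← Finset.sum_add_distrib]
  exact Finset.sum_congr rfl fun s _ => by simp only [Nat.succ_eq_add_one]; ring

/-- A partition either contains the part `1`, which can be removed, or all its parts can be
lowered by one. -/
theorem bijective_add_single_mapDomain_succ :
    Function.Bijective (Sum.elim (fun m : ℕ →₀ ℕ => m + Finsupp.single 0 1)
      (fun m : ℕ →₀ ℕ => m.mapDomain Nat.succ)) := by
  have h0 (m : ℕ →₀ ℕ) : m.mapDomain Nat.succ 0 = 0 :=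
    Finsupp.mapDomain_of_notMem_range _ _ (by simp)
  constructor
  · rintro (a | a) (b | b) h
    · simpa using h
    · simpa [h0] using DFunLike.congr_fun h 0
    · simpa [h0] using DFunLike.congr_fun h 0
    · exact congrArg _ (Finsupp.mapDomain_injective Nat.succ_injective h)
  · intro m
    by_cases hm : m 0 = 0
    · refine ⟨.inr (m.comapDomain Nat.succ Nat.succ_injective.injOn), ?_⟩
      ext s
      cases s with
      | zero => simp [h0, hm]
      | succ s =>
        simp only [Sum.elim_inr]
        exact (Finsupp.mapDomain_apply Nat.succ_injective _ s).trans rfl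
    · refine ⟨.inl (m - Finsupp.single 0 1), ?_⟩
      simp only [Sum.elim_inl]
      exact tsub_add_cancel_of_le (by simpa using Nat.one_le_iff_ne_zero.2 hm)

/-- A partition is determined by the finite set of pairs `(s, m s)` with `m s ≠ 0`, and the series
over all finite sets of pairs converges because `∑ r ^ s * r ^ k` does. -/
theorem summable_real_pow_partSize {r : ℝ} (hr0 : 0 ≤ r) (hr : r < 1) :
    Summable fun m : ℕ →₀ ℕ => r ^ partSize m := by
  have hgeo := summable_geometric_of_lt_one hr0 hr
  have hpair : Summable fun p : ℕ × ℕ => r ^ p.1 * r ^ p.2 :=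
    hgeo.mul_of_nonneg hgeo (fun _ => by positivity) fun _ => by positivity
  have hfin := summable_finsetProd_of_summable_nonneg (fun _ => by positivity) hpair
  refine Summable.of_nonneg_of_le (fun m => by positivity) (fun m => ?_)
    (hfin.comp_injective (Finsupp.graph_injective ℕ ℕ))
  simp only [Function.comp_apply, ← pow_add]
  rw [Finset.prod_pow_eq_pow_sum]
  refine pow_le_pow_of_le_one hr0 hr.le ?_
  -- It remains that `s + k ≤ k * (s + 1)` for `k = m s ≥ 1`.
  rw [partSize_eq_sum, Finsupp.sum, Finsupp.graph, Finset.sum_map]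
  refine Finset.sum_le_sum fun s hs => ?_
  have : 1 ≤ m s := Nat.one_le_iff_ne_zero.2 (Finsupp.mem_support_iff.1 hs)
  change s + m s ≤ m s * (s + 1)
  nlinarith

section

variable {q : ℂ}

theorem summable_norm_pow_partSize (hq : ‖q‖ < 1) :
    Summable fun m : ℕ →₀ ℕ => ‖q ^ partSize m‖ := by
  simpa only [norm_pow] using summable_real_pow_partSize (norm_nonneg q) hq

theorem one_sub_ne_zero (hq : ‖q‖ < 1) : 1 - q ≠ 0 := by
  intro h
  rw [← sub_eq_zero.1 h, norm_one] at hq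
  exact hq.false

theorem norm_pow_lt_one (hq : ‖q‖ < 1) {k : ℕ} (hk : k ≠ 0) : ‖q ^ k‖ < 1 := by
  rw [norm_pow]
  exact pow_lt_one₀ (norm_nonneg q) hq hk

theorem qPochhammer_succ (a p : ℂ) (n : ℕ) :
    qPochhammer a p (n + 1) = qPochhammer a p n * (1 - a * p ^ n) :=
  Finset.prod_range_succ _ _

theorem qPochhammer_self_ne_zero (hq : ‖q‖ < 1) (n : ℕ) : qPochhammer q q n ≠ 0 :=
  Finset.prod_ne_zero_iff.2 fun k _ => by
    rw [← pow_succ']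
    exact one_sub_ne_zero (norm_pow_lt_one hq k.succ_ne_zero)

theorem norm_pow_partSize_add_le (hq : ‖q‖ < 1) (n : ℕ) (m : ℕ →₀ ℕ) :
    ‖q ^ (partSize m + n * m.degree)‖ ≤ ‖q ^ partSize m‖ := by
  rw [norm_pow, norm_pow]
  exact pow_le_pow_of_le_one (norm_nonneg q) hq.le (Nat.le_add_right _ _)

/-- The generating function of all partitions, times `(q; q)_n`, is the generating function of the
partitions with all parts larger than `n`, here written with all parts lowered by `n`. -/
theorem tsum_pow_partSize_mul_qPochhammer (hq : ‖q‖ < 1) (n : ℕ) :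
    (∑' m : ℕ →₀ ℕ, q ^ partSize m) * qPochhammer q q n =
      ∑' m : ℕ →₀ ℕ, q ^ (partSize m + n * m.degree) := by
  induction n with
  | zero => simp [qPochhammer]
  | succ n ih =>
    have hs : Summable fun m : ℕ →₀ ℕ => q ^ (partSize m + n * m.degree) :=
      .of_norm_bounded (summable_norm_pow_partSize hq) (norm_pow_partSize_add_le hq n)
    have key := tsum_eq_add_of_bijective_sumElim bijective_add_single_mapDomain_succ hs
    have h1 (m : ℕ →₀ ℕ) : q ^ (partSize (m + Finsupp.single 0 1) +
        n * (m + Finsupp.single 0 1).degree) = q ^ (n + 1) * q ^ (partSize m + n * m.degree) := by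
      rw [map_add, map_add, partSize_single, Finsupp.degree_single]
      ring
    have h2 (m : ℕ →₀ ℕ) : q ^ (partSize (m.mapDomain Nat.succ) +
        n * (m.mapDomain Nat.succ).degree) = q ^ (partSize m + (n + 1) * m.degree) := by
      rw [partSize_mapDomain_succ, Finsupp.degree_mapDomain]
      ring
    simp only [h1, h2, tsum_mul_left] at key
    rw [qPochhammer_succ, ← mul_assoc, ih]
    linear_combination key

theorem tendsto_tsum_pow_partSize_add (hq : ‖q‖ < 1) :
    Tendsto (fun n : ℕ => ∑' m : ℕ →₀ ℕ, q ^ (partSize m + n * m.degree)) atTop (𝓝 1) := by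
  rw [← tsum_ite_eq (0 : ℕ →₀ ℕ) fun _ => (1 : ℂ)]
  refine tendsto_tsum_of_dominated_convergence (summable_norm_pow_partSize hq) (fun m => ?_)
    (.of_forall fun n m => norm_pow_partSize_add_le hq n m)
  split_ifs with hm
  · simp [hm]
  · have hd : m.degree ≠ 0 := by simpa [Finsupp.degree_eq_zero_iff] using hm
    have := (tendsto_pow_atTop_nhds_zero_of_norm_lt_one (norm_pow_lt_one hq hd)).const_mul
      (q ^ partSize m)
    simpa [pow_add, pow_mul'] using this

/-- `(q; q)_n` tends to the inverse of the generating function of partitions; in particular that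
generating function does not vanish. -/
theorem tsum_pow_partSize_ne_zero_and_tendsto (hq : ‖q‖ < 1) :
    (∑' m : ℕ →₀ ℕ, q ^ partSize m) ≠ 0 ∧
      Tendsto (fun n => qPochhammer q q n) atTop (𝓝 (∑' m : ℕ →₀ ℕ, q ^ partSize m)⁻¹) := by
  have h := tendsto_tsum_pow_partSize_add hq
  simp only [← tsum_pow_partSize_mul_qPochhammer hq] at h
  have hP : (∑' m : ℕ →₀ ℕ, q ^ partSize m) ≠ 0 := by
    intro h0
    simp only [h0, zero_mul] at h
    exact zero_ne_one (tendsto_nhds_unique tendsto_const_nhds h)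
  refine ⟨hP, ?_⟩
  simpa [hP] using h.const_mul (∑' m : ℕ →₀ ℕ, q ^ partSize m)⁻¹

theorem qPochhammerInf_eq {a p x : ℂ} (h : Tendsto (fun n => qPochhammer a p n) atTop (𝓝 x)) :
    qPochhammerInf a p = x :=
  h.limUnder_eq

theorem qPochhammerInf_self (hq : ‖q‖ < 1) :
    qPochhammerInf q q = (∑' m : ℕ →₀ ℕ, q ^ partSize m)⁻¹ :=
  qPochhammerInf_eq (tsum_pow_partSize_ne_zero_and_tendsto hq).2

theorem exists_norm_inv_qPochhammer_self_le (hq : ‖q‖ < 1) :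
    ∃ C : ℝ, ∀ n, ‖(qPochhammer q q n)⁻¹‖ ≤ C := by
  obtain ⟨hP, h⟩ := tsum_pow_partSize_ne_zero_and_tendsto hq
  obtain ⟨C, hC⟩ := isBounded_iff_forall_norm_le.1
    (Metric.isBounded_range_of_tendsto _ (h.inv₀ (inv_ne_zero hP)))
  exact ⟨C, fun n => hC _ ⟨n, rfl⟩⟩

/-- Any series `∑ q ^ e n / (q; q)_n` with `n ≤ e n` converges absolutely. -/
theorem summable_norm_pow_div_qPochhammer (hq : ‖q‖ < 1) {p : ℂ} (hp : ‖p‖ < 1) {e : ℕ → ℕ}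
    (he : ∀ n, n ≤ e n) : Summable fun n => ‖q ^ e n / qPochhammer p p n‖ := by
  obtain ⟨C, hC⟩ := exists_norm_inv_qPochhammer_self_le hp
  refine .of_nonneg_of_le (fun _ => norm_nonneg _) (fun n => ?_)
    ((summable_geometric_of_lt_one (norm_nonneg q) hq).mul_right C)
  rw [div_eq_mul_inv, norm_mul, norm_pow]
  exact mul_le_mul (pow_le_pow_of_le_one (norm_nonneg q) hq.le (he n)) (hC n) (norm_nonneg _)
    (by positivity)

end

open Finset (HasAntidiagonal)

/-! ### A transformation of the Rogers–Ramanujan series -/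

section

variable {q : ℂ}

theorem norm_sq_lt_one (hq : ‖q‖ < 1) : ‖q ^ 2‖ < 1 := norm_pow_lt_one hq two_ne_zero

theorem inv_qPochhammer_self_succ {p : ℂ} (hp : ‖p‖ < 1) (n : ℕ) :
    (qPochhammer p p (n + 1))⁻¹ * (1 - p ^ (n + 1)) = (qPochhammer p p n)⁻¹ := by
  have h1 := one_sub_ne_zero (norm_pow_lt_one hp n.succ_ne_zero)
  rw [qPochhammer_succ, ← pow_succ', mul_inv, mul_assoc, inv_mul_cancel₀ h1, mul_one]

/-- The coefficients of `1 / ((z; q²)_∞ (z q; q²)_∞) = 1 / (z; q)_∞`, where each of the three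
products is expanded by Euler's series. -/
theorem sum_antidiagonal_pow_mul_inv_qPochhammer (hq : ‖q‖ < 1) (N : ℕ) :
    ∑ x ∈ HasAntidiagonal.antidiagonal N, q ^ x.2 * (qPochhammer (q ^ 2) (q ^ 2) x.1)⁻¹ *
      (qPochhammer (q ^ 2) (q ^ 2) x.2)⁻¹ = (qPochhammer q q N)⁻¹ := by
  have hp := norm_sq_lt_one hq
  set c : ℕ → ℂ := fun n => (qPochhammer (q ^ 2) (q ^ 2) n)⁻¹ with hc
  have hcs (n : ℕ) : c (n + 1) * (1 - (q ^ 2) ^ (n + 1)) = c n := inv_qPochhammer_self_succ hp n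
  change ∑ x ∈ HasAntidiagonal.antidiagonal N, q ^ x.2 * c x.1 * c x.2 = _
  induction N with
  | zero => simp [hc, qPochhammer]
  | succ N ih =>
    -- Multiplying by `q ^ (N + 1)` exchanges the two products, hence amounts to the factor
    -- `q ^ (2 * x.1)`, and `1 - q ^ (2 * x.1)` cancels a factor of the denominator.
    have hswap : q ^ (N + 1) * ∑ x ∈ HasAntidiagonal.antidiagonal (N + 1), q ^ x.2 * c x.1 * c x.2 =
        ∑ x ∈ HasAntidiagonal.antidiagonal (N + 1), (q ^ 2) ^ x.1 * (q ^ x.2 * c x.1 * c x.2) := by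
      rw [Finset.mul_sum, ← Finset.Nat.sum_antidiagonal_swap]
      refine Finset.sum_congr rfl fun x hx => ?_
      rw [← HasAntidiagonal.mem_antidiagonal.1 hx]
      simp only [Prod.fst_swap, Prod.snd_swap]
      ring
    have hrec : (∑ x ∈ HasAntidiagonal.antidiagonal (N + 1), q ^ x.2 * c x.1 * c x.2) *
        (1 - q ^ (N + 1)) = (qPochhammer q q N)⁻¹ := by
      rw [mul_sub, mul_one, mul_comm _ (q ^ (N + 1)), hswap, ← Finset.sum_sub_distrib,
        Finset.Nat.sum_antidiagonal_succ, ← ih]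
      simp only [pow_zero, one_mul, sub_self, zero_add]
      refine Finset.sum_congr rfl fun x _ => ?_
      rw [← hcs x.1]
      ring
    rw [← inv_qPochhammer_self_succ hq N] at hrec
    exact mul_right_cancel₀ (one_sub_ne_zero (norm_pow_lt_one hq N.succ_ne_zero)) hrec

/-- Euler's series for `(-q ^ (2 * n + 2); q²)_∞`. -/
noncomputable def eulerSeries (q : ℂ) (n : ℕ) : ℂ :=
  ∑' m : ℕ, q ^ (m ^ 2 + m + 2 * n * m) / qPochhammer (q ^ 2) (q ^ 2) m

theorem summable_norm_eulerSeries (hq : ‖q‖ < 1) (n : ℕ) :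
    Summable fun m : ℕ => ‖q ^ (m ^ 2 + m + 2 * n * m) / qPochhammer (q ^ 2) (q ^ 2) m‖ :=
  summable_norm_pow_div_qPochhammer hq (norm_sq_lt_one hq) fun m => by nlinarith

/-- The functional equation `E a = (1 + a) * E (a * q ^ 2)` at `a = q ^ (2 * n + 2)`. -/
theorem eulerSeries_eq_mul (hq : ‖q‖ < 1) (n : ℕ) :
    eulerSeries q n = (1 + q ^ (2 * n + 2)) * eulerSeries q (n + 1) := by
  have hs (n : ℕ) := (summable_norm_eulerSeries hq n).of_norm
  have hd : eulerSeries q n - eulerSeries q (n + 1) =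
      q ^ (2 * n + 2) * eulerSeries q (n + 1) := by
    rw [eulerSeries, eulerSeries, ← (hs n).tsum_sub (hs (n + 1)),
      ((hs n).sub (hs (n + 1))).tsum_eq_zero_add, ← tsum_mul_left]
    simp only [ne_eq, OfNat.ofNat_ne_zero, not_false_eq_true, zero_pow, mul_zero, add_zero,
      pow_zero, sub_self, zero_add]
    refine tsum_congr fun m => ?_
    rw [div_eq_mul_inv, div_eq_mul_inv, div_eq_mul_inv,
      ← inv_qPochhammer_self_succ (norm_sq_lt_one hq) m]
    ring
  linear_combination hd

theorem tendsto_eulerSeries (hq : ‖q‖ < 1) : Tendsto (eulerSeries q) atTop (𝓝 1) := by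
  rw [← tsum_ite_eq (0 : ℕ) fun _ => (1 : ℂ)]
  refine tendsto_tsum_of_dominated_convergence (summable_norm_eulerSeries hq 0) (fun m => ?_)
    (.of_forall fun n m => ?_)
  · split_ifs with hm
    · simp [hm, qPochhammer]
    · have := (tendsto_pow_atTop_nhds_zero_of_norm_lt_one
        (norm_pow_lt_one hq (mul_ne_zero two_ne_zero hm))).const_mul
        (q ^ (m ^ 2 + m) / qPochhammer (q ^ 2) (q ^ 2) m)
      rw [mul_zero] at this
      refine this.congr fun n => ?_
      ring
  · rw [norm_div, norm_div, norm_pow, norm_pow]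
    gcongr ?_ / _
    exact pow_le_pow_of_le_one (norm_nonneg q) hq.le (by simp)

theorem qPochhammer_mul_eulerSeries (hq : ‖q‖ < 1) (n : ℕ) :
    qPochhammer (-q ^ 2) (q ^ 2) n * eulerSeries q n = eulerSeries q 0 := by
  induction n with
  | zero => simp [qPochhammer]
  | succ n ih =>
    rw [← ih, qPochhammer_succ, eulerSeries_eq_mul hq n]
    ring

theorem tendsto_qPochhammer_neg_sq (hq : ‖q‖ < 1) :
    Tendsto (fun n => qPochhammer (-q ^ 2) (q ^ 2) n) atTop (𝓝 (eulerSeries q 0)) := by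
  have hE := tendsto_eulerSeries hq
  have h := (tendsto_const_nhds (x := eulerSeries q 0)).div hE one_ne_zero
  rw [div_one] at h
  refine h.congr' ?_
  filter_upwards [hE.eventually_ne one_ne_zero] with n hn
  rw [Pi.div_apply, ← qPochhammer_mul_eulerSeries hq n, mul_div_cancel_right₀ _ hn]

theorem qPochhammer_sq_mul_neg_sq (q : ℂ) (n : ℕ) :
    qPochhammer (q ^ 2) (q ^ 2) n * qPochhammer (-q ^ 2) (q ^ 2) n =
      qPochhammer (q ^ 4) (q ^ 4) n := by
  rw [qPochhammer, qPochhammer, qPochhammer, ← Finset.prod_mul_distrib]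
  exact Finset.prod_congr rfl fun k _ => by ring

theorem tsum_prod_eq_tsum_sum_antidiagonal {F : ℕ × ℕ → ℂ} (hF : Summable F) :
    ∑' x, F x = ∑' N, ∑ x ∈ HasAntidiagonal.antidiagonal N, F x := by
  have hs := HasAntidiagonal.sigmaAntidiagonalEquivProd.summable_iff.2 hF
  rw [← HasAntidiagonal.sigmaAntidiagonalEquivProd.tsum_eq F]
  exact hs.tsum_sigma.trans
    (tsum_congr fun N => Finset.tsum_subtype (HasAntidiagonal.antidiagonal N) F)

theorem summable_pow_mul_inv_qPochhammer_mul (hq : ‖q‖ < 1) :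
    Summable fun x : ℕ × ℕ => q ^ ((x.1 + x.2) ^ 2 + x.2) *
      ((qPochhammer (q ^ 2) (q ^ 2) x.1)⁻¹ * (qPochhammer (q ^ 2) (q ^ 2) x.2)⁻¹) := by
  have hg : Summable fun n => ‖q ^ n / qPochhammer (q ^ 2) (q ^ 2) n‖ :=
    summable_norm_pow_div_qPochhammer hq (norm_sq_lt_one hq) fun n => le_rfl
  refine .of_norm_bounded (hg.mul_of_nonneg hg (fun _ => norm_nonneg _) fun _ => norm_nonneg _)
    fun x => ?_
  have hx := Nat.le_self_pow two_ne_zero (x.1 + x.2)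
  rw [← norm_mul, div_eq_mul_inv, div_eq_mul_inv, mul_mul_mul_comm, ← pow_add, norm_mul,
    norm_mul (q ^ (x.1 + x.2)), norm_pow, norm_pow]
  gcongr ?_ * _
  exact pow_le_pow_of_le_one (norm_nonneg q) hq.le (by omega)

/-- The substitution of Euler's series for `(-q ^ (2 * n + 2); q²)_∞` turns the left-hand side into
a double series, which is then summed along the antidiagonals. -/
theorem tsum_pow_sq_div_qPochhammer_mul_eulerSeries (hq : ‖q‖ < 1) :
    (∑' n : ℕ, q ^ n ^ 2 / qPochhammer (q ^ 4) (q ^ 4) n) * eulerSeries q 0 =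
      ∑' N : ℕ, q ^ N ^ 2 / qPochhammer q q N := by
  have h4 : ‖q ^ 4‖ < 1 := norm_pow_lt_one hq four_ne_zero
  have hF := summable_pow_mul_inv_qPochhammer_mul hq
  trans ∑' x : ℕ × ℕ, q ^ ((x.1 + x.2) ^ 2 + x.2) *
      ((qPochhammer (q ^ 2) (q ^ 2) x.1)⁻¹ * (qPochhammer (q ^ 2) (q ^ 2) x.2)⁻¹)
  · rw [hF.tsum_prod, ← tsum_mul_right]
    refine tsum_congr fun n => ?_
    have hm : qPochhammer (-q ^ 2) (q ^ 2) n ≠ 0 := by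
      refine right_ne_zero_of_mul (a := qPochhammer (q ^ 2) (q ^ 2) n) ?_
      rw [qPochhammer_sq_mul_neg_sq]
      exact qPochhammer_self_ne_zero h4 n
    rw [← qPochhammer_mul_eulerSeries hq n, ← qPochhammer_sq_mul_neg_sq, ← mul_assoc,
      ← div_div, div_mul_cancel₀ _ hm, eulerSeries, ← tsum_mul_left]
    refine tsum_congr fun m => ?_
    rw [div_eq_mul_inv, div_eq_mul_inv]
    ring
  · rw [tsum_prod_eq_tsum_sum_antidiagonal hF]
    refine tsum_congr fun N => ?_
    rw [div_eq_mul_inv, ← sum_antidiagonal_pow_mul_inv_qPochhammer hq, Finset.mul_sum]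
    refine Finset.sum_congr rfl fun x hx => ?_
    rw [← HasAntidiagonal.mem_antidiagonal.1 hx]
    ring

end

/-! ### Sets without consecutive elements -/

/-- A finite set of natural numbers without two consecutive elements. The element `s` stands for
the part `s + 1`, so this is a partition whose parts differ by at least two. -/
abbrev SparseSet : Type := {T : Finset ℕ // ∀ s ∈ T, s + 1 ∉ T}

namespace SparseSet

/-- The size of the partition with parts `s + 1`, for `s` in the set. -/
def size (T : SparseSet) : ℕ := ∑ s ∈ T.1, (s + 1)

/-- All elements raised by one. -/
def shift (T : SparseSet) : SparseSet :=
  ⟨T.1.image (· + 1), by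
    have := T.2
    simp only [Finset.mem_image]
    grind⟩

/-- All elements raised by two, together with the element `0`. -/
def insertZero (T : SparseSet) : SparseSet :=
  ⟨insert 0 (T.1.image (· + 2)), by
    have := T.2
    simp only [Finset.mem_insert, Finset.mem_image]
    grind⟩

theorem card_shift (T : SparseSet) : T.shift.1.card = T.1.card :=
  Finset.card_image_of_injective _ (add_left_injective 1)

theorem size_shift (T : SparseSet) : T.shift.size = T.size + T.1.card := by
  rw [size, shift, Finset.sum_image (add_left_injective 1).injOn, size, Finset.card_eq_sum_ones,
    ← Finset.sum_add_distrib]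

theorem zero_notMem_image_add_two (T : Finset ℕ) : 0 ∉ T.image (· + 2) := by simp

theorem card_insertZero (T : SparseSet) : T.insertZero.1.card = T.1.card + 1 := by
  rw [insertZero, Finset.card_insert_of_notMem (zero_notMem_image_add_two _),
    Finset.card_image_of_injective _ (add_left_injective 2)]

theorem size_insertZero (T : SparseSet) : T.insertZero.size = T.size + 2 * T.1.card + 1 := by
  rw [size, insertZero, Finset.sum_insert (zero_notMem_image_add_two _),
    Finset.sum_image (add_left_injective 2).injOn, size, Finset.card_eq_sum_ones, Finset.mul_sum,
    ← Finset.sum_add_distrib, zero_add, add_comm]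
  exact congrArg (· + 1) (Finset.sum_congr rfl fun s _ => by ring)

theorem bijective_shift_insertZero : Function.Bijective (Sum.elim shift insertZero) := by
  have hs (T : SparseSet) (s : ℕ) : s ∈ T.shift.1 ↔ ∃ t ∈ T.1, t + 1 = s := by simp [shift]
  have hi (T : SparseSet) (s : ℕ) : s ∈ T.insertZero.1 ↔ s = 0 ∨ ∃ t ∈ T.1, t + 2 = s := by
    simp [insertZero]
  constructor
  · rintro (a | a) (b | b) h <;> simp only [Sum.elim_inl, Sum.elim_inr] at h
    · refine congrArg _ (Subtype.ext (Finset.ext fun s => ?_))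
      have := hs a (s + 1)
      rw [h, hs] at this
      simpa using this.symm
    · have := hs a 0
      rw [h, hi] at this
      simp at this
    · have := hs b 0
      rw [← h, hi] at this
      simp at this
    · refine congrArg _ (Subtype.ext (Finset.ext fun s => ?_))
      have := hi a (s + 2)
      rw [h, hi] at this
      simpa using this.symm
  · intro T
    by_cases h0 : 0 ∈ T.1
    · refine ⟨.inr ⟨T.1.preimage (· + 2) (add_left_injective 2).injOn, ?_⟩, ?_⟩
      · simp only [Finset.mem_preimage]
        exact fun s hs => T.2 _ hs
      · refine Subtype.ext (Finset.ext fun s => ?_)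
        have h1 : 1 ∉ T.1 := T.2 0 h0
        rw [Sum.elim_inr, hi]
        simp only [Finset.mem_preimage]
        match s with
        | 0 => simp [h0]
        | 1 => simp [h1]
        | s + 2 => simp
    · refine ⟨.inl ⟨T.1.preimage (· + 1) (add_left_injective 1).injOn, ?_⟩, ?_⟩
      · simp only [Finset.mem_preimage]
        exact fun s hs => T.2 _ hs
      · refine Subtype.ext (Finset.ext fun s => ?_)
        rw [Sum.elim_inl, hs]
        simp only [Finset.mem_preimage]
        match s with
        | 0 => simp [h0]
        | s + 1 => simp

variable {q : ℂ}

theorem summable_norm_pow_size (hq : ‖q‖ < 1) : Summable fun T : SparseSet => ‖q ^ T.size‖ := by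
  have hf : Summable fun s : ℕ => ‖q‖ ^ (s + 1) :=
    (summable_nat_add_iff 1).2 (summable_geometric_of_lt_one (norm_nonneg q) hq)
  have := (summable_finsetProd_of_summable_nonneg (fun _ => by positivity) hf).comp_injective
    (Subtype.val_injective (p := fun T : Finset ℕ => ∀ s ∈ T, s + 1 ∉ T))
  refine this.congr fun T => ?_
  rw [norm_pow, size, Function.comp_apply, Finset.prod_pow_eq_pow_sum]

theorem summable_ite_card_pow_size (hq : ‖q‖ < 1) (n : ℕ) :
    Summable fun T : SparseSet => if T.1.card = n then q ^ T.size else 0 :=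
  .of_norm_bounded (summable_norm_pow_size hq) fun T => by split_ifs <;> simp

/-- A sparse set either contains `0`, and is then an `insertZero`, or is a `shift`; sorted by
cardinality, this gives a recurrence whose solution is `q ^ n ^ 2 / (q; q)_n`. -/
theorem tsum_ite_card_pow_size (hq : ‖q‖ < 1) (n : ℕ) :
    ∑' T : SparseSet, (if T.1.card = n then q ^ T.size else 0) =
      q ^ n ^ 2 / qPochhammer q q n := by
  induction n with
  | zero =>
    rw [tsum_eq_single (⟨∅, by simp⟩ : SparseSet)]
    · simp [size, qPochhammer]
    · intro T hT
      refine if_neg fun h => hT (Subtype.ext (Finset.card_eq_zero.1 h))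
  | succ n ih =>
    have key := tsum_eq_add_of_bijective_sumElim bijective_shift_insertZero
      (summable_ite_card_pow_size hq (n + 1))
    have h1 (T : SparseSet) : (if T.shift.1.card = n + 1 then q ^ T.shift.size else 0) =
        q ^ (n + 1) * if T.1.card = n + 1 then q ^ T.size else 0 := by
      rw [card_shift, size_shift]
      split_ifs with h
      · rw [h]; ring
      · simp
    have h2 (T : SparseSet) :
        (if T.insertZero.1.card = n + 1 then q ^ T.insertZero.size else 0) =
        q ^ (2 * n + 1) * if T.1.card = n then q ^ T.size else 0 := by
      simp only [card_insertZero, size_insertZero, add_left_inj]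
      split_ifs with h
      · rw [h]; ring
      · simp
    simp only [h1, h2, tsum_mul_left] at key
    rw [ih] at key
    have hn : 1 - q ^ (n + 1) ≠ 0 := one_sub_ne_zero (norm_pow_lt_one hq n.succ_ne_zero)
    have hP := qPochhammer_self_ne_zero hq n
    rw [qPochhammer_succ, ← pow_succ', eq_div_iff (mul_ne_zero hP hn)]
    rw [mul_div_assoc', ← sub_eq_iff_eq_add', eq_div_iff hP] at key
    linear_combination key

/-- The generating function of the partitions whose parts differ by at least two, sorted by the
number of parts. -/
theorem hasSum_pow_size (hq : ‖q‖ < 1) :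
    HasSum (fun T : SparseSet => q ^ T.size) (∑' n : ℕ, q ^ n ^ 2 / qPochhammer q q n) := by
  have hs := (summable_norm_pow_size hq).of_norm
  suffices h : ∑' n : ℕ, q ^ n ^ 2 / qPochhammer q q n = ∑' T : SparseSet, q ^ T.size from
    h ▸ hs.hasSum
  rw [← (hs.hasSum.tsum_fiberwise fun T : SparseSet => T.1.card).tsum_eq]
  refine tsum_congr fun n => ?_
  rw [← tsum_ite_card_pow_size hq]
  refine Eq.trans (tsum_congr fun T => ?_) (tsum_subtype _ fun T : SparseSet => q ^ T.size).symm
  classical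
  rw [Set.indicator_apply]
  exact if_congr Iff.rfl rfl rfl

end SparseSet

/-! ### Cylindric partitions of profile `(2, 1)` as pairs of partitions -/

/-- The sequence with entry `∑ s ≥ i, d s` at `i`. It is the conjugate of the partition in which the
part `s + 1` occurs `d s` times. -/
noncomputable def tailSum : (ℕ →₀ ℕ) →+ (ℕ →₀ ℕ) :=
  Finsupp.liftAddHom fun s => ∑ i ∈ Finset.range (s + 1), Finsupp.singleAddHom i

theorem tailSum_single (s k : ℕ) :
    tailSum (Finsupp.single s k) = ∑ i ∈ Finset.range (s + 1), Finsupp.single i k := by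
  simp [tailSum]

theorem tailSum_apply (d : ℕ →₀ ℕ) (i : ℕ) : tailSum d i = tailSum d (i + 1) + d i := by
  induction d using Finsupp.induction_linear with
  | zero => simp
  | add d e hd he => simp only [map_add, Finsupp.add_apply, hd, he]; ring
  | single s k =>
    simp only [tailSum_single, Finsupp.finsetSum_apply, Finsupp.single_apply]
    simp only [Finset.sum_ite_eq', Finset.mem_range]
    grind

theorem degree_tailSum (d : ℕ →₀ ℕ) : (tailSum d).degree = partSize d := by
  induction d using Finsupp.induction_linear with
  | zero => simp
  | add d e hd he => simp only [map_add, hd, he]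
  | single s k => simp [tailSum_single, mul_comm]

theorem antitone_tailSum (d : ℕ →₀ ℕ) : Antitone (tailSum d) :=
  antitone_nat_of_succ_le fun i => by rw [tailSum_apply d i]; exact Nat.le_add_right _ _

theorem tailSum_injective : Function.Injective tailSum := fun d e h => by
  ext i
  have hd := tailSum_apply d i
  rw [h, tailSum_apply e i] at hd
  omega

theorem exists_tailSum_eq {y : ℕ →₀ ℕ} (hy : Antitone y) : ∃ d, tailSum d = y := by
  -- The consecutive differences determine `y`, because it vanishes eventually.
  let d : ℕ →₀ ℕ := Finsupp.onFinset y.support (fun i => y i - y (i + 1)) fun i hi => by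
    rw [Finsupp.mem_support_iff]
    omega
  have hd (i : ℕ) : y i = y (i + 1) + d i := by
    have : y (i + 1) ≤ y i := hy i.le_succ
    simp only [d, Finsupp.onFinset_apply]
    omega
  refine ⟨d, ?_⟩
  obtain ⟨N, hN⟩ := ((tailSum d).support ∪ y.support).exists_nat_subset_range
  have hzero : ∀ i, N ≤ i → tailSum d i = y i := fun i hi => by
    have : i ∉ (tailSum d).support ∪ y.support := fun h => by
      have := Finset.mem_range.1 (hN h)
      omega
    simp only [Finset.mem_union, Finsupp.mem_support_iff, not_or, not_not] at this
    rw [this.1, this.2]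
  ext i
  rcases le_total N i with hi | hi
  · exact hzero i hi
  · induction hi using Nat.decreasingInduction with
    | self => exact hzero N le_rfl
    | of_succ k _ ih => rw [tailSum_apply, ih, hd k]

namespace SparseSet

/-- The permutation of `ℕ` that exchanges `s` and `s + 1` for every `s` in the set. -/
def swapFun (T : SparseSet) : ℕ → ℕ
  | 0 => if 0 ∈ T.1 then 1 else 0
  | i + 1 => if i ∈ T.1 then i else if i + 1 ∈ T.1 then i + 2 else i + 1

theorem swapFun_of_mem {T : SparseSet} {i : ℕ} (hi : i ∈ T.1) : T.swapFun i = i + 1 := by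
  cases i with
  | zero => simp [swapFun, hi]
  | succ i => simp [swapFun, hi, show i ∉ T.1 from fun h => T.2 i h hi]

theorem swapFun_succ_of_mem {T : SparseSet} {i : ℕ} (hi : i ∈ T.1) : T.swapFun (i + 1) = i := by
  simp [swapFun, hi]

theorem swapFun_le_of_notMem {T : SparseSet} {i : ℕ} (hi : i ∉ T.1) : T.swapFun i ≤ i := by
  cases i with
  | zero => simp [swapFun, hi]
  | succ i => rw [swapFun]; split_ifs <;> omega

theorem lt_swapFun_succ_of_notMem {T : SparseSet} {i : ℕ} (hi : i ∉ T.1) :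
    i < T.swapFun (i + 1) := by
  rw [swapFun, if_neg hi]; split_ifs <;> omega

theorem swapFun_le (T : SparseSet) (i : ℕ) : T.swapFun i ≤ i + 1 := by
  cases i <;> rw [swapFun] <;> split_ifs <;> omega

theorem le_swapFun_succ (T : SparseSet) (i : ℕ) : i ≤ T.swapFun (i + 1) := by
  rw [swapFun]; split_ifs <;> omega

theorem swapFun_involutive (T : SparseSet) : Function.Involutive T.swapFun := by
  intro i
  by_cases hi : i ∈ T.1
  · rw [swapFun_of_mem hi, swapFun_succ_of_mem hi]
  cases i with
  | zero => simp [swapFun, hi]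
  | succ i =>
    by_cases hj : i ∈ T.1
    · rw [swapFun_succ_of_mem hj, swapFun_of_mem hj]
    · simp [swapFun, hi, hj]

/-- The multiplicities of the parts `s + 1`, for `s` in the set. -/
noncomputable def indicator (T : SparseSet) : ℕ →₀ ℕ := ∑ s ∈ T.1, Finsupp.single s 1

theorem indicator_apply (T : SparseSet) (i : ℕ) : T.indicator i = if i ∈ T.1 then 1 else 0 := by
  simp [indicator, Finsupp.finsetSum_apply, Finsupp.single_apply]

theorem partSize_indicator (T : SparseSet) : partSize T.indicator = T.size := by
  simp [indicator, size]

/-- The conjugate of the partition whose parts are those of `m` together with those of `T`, with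
entries `s` and `s + 1` exchanged for every `s` in `T`. -/
noncomputable def merge (T : SparseSet) (m : ℕ →₀ ℕ) : ℕ →₀ ℕ :=
  Finsupp.equivMapDomain T.swapFun_involutive.toPerm (tailSum (m + T.indicator))

theorem merge_apply (T : SparseSet) (m : ℕ →₀ ℕ) (i : ℕ) :
    T.merge m i = tailSum (m + T.indicator) (T.swapFun i) := rfl

theorem degree_equivMapDomain (e : Equiv.Perm ℕ) (x : ℕ →₀ ℕ) :
    (Finsupp.equivMapDomain e x).degree = x.degree := by
  rw [Finsupp.equivMapDomain_eq_mapDomain, Finsupp.degree_mapDomain]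

theorem degree_merge (T : SparseSet) (m : ℕ →₀ ℕ) :
    (T.merge m).degree = partSize m + T.size := by
  rw [merge, degree_equivMapDomain, degree_tailSum, map_add, partSize_indicator]

/-- The sorted sequence drops strictly from `i` to `i + 1` when `i ∈ T`, so that the exchange creates
an ascent there, and there are no other ascents. -/
theorem merge_lt_merge_succ_iff {T : SparseSet} {m : ℕ →₀ ℕ} {i : ℕ} :
    T.merge m i < T.merge m (i + 1) ↔ i ∈ T.1 := by
  rw [merge_apply, merge_apply]
  constructor
  · intro h
    by_contra hi
    exact h.not_ge (antitone_tailSum _ ((swapFun_le_of_notMem hi).trans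
      (lt_swapFun_succ_of_notMem hi).le))
  · intro hi
    rw [swapFun_of_mem hi, swapFun_succ_of_mem hi, tailSum_apply _ i, Finsupp.add_apply,
      indicator_apply, if_pos hi]
    omega

end SparseSet

/-- Every entry is at least as large as all later entries except possibly the next one. It suffices
to compare entries at distance two and three, since every larger distance is a sum of twos and
threes. -/
def NearlyAntitone (x : ℕ → ℕ) : Prop := ∀ n, x (n + 2) ≤ x n ∧ x (n + 3) ≤ x n

namespace SparseSet

theorem nearlyAntitone_merge (T : SparseSet) (m : ℕ →₀ ℕ) : NearlyAntitone (T.merge m) :=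
  fun n => ⟨antitone_tailSum _ ((T.swapFun_le n).trans (T.le_swapFun_succ (n + 1))),
    antitone_tailSum _ ((T.swapFun_le n).trans
      ((Nat.le_succ _).trans (T.le_swapFun_succ (n + 2))))⟩

theorem merge_injective : Function.Injective fun p : SparseSet × (ℕ →₀ ℕ) => p.1.merge p.2 := by
  rintro ⟨T, m⟩ ⟨U, n⟩ h
  dsimp only at h
  obtain rfl : T = U := Subtype.ext <| Finset.ext fun i => by
    rw [← merge_lt_merge_succ_iff (m := m), h, merge_lt_merge_succ_iff]
  refine congrArg _ (add_right_cancel (b := T.indicator) (tailSum_injective ?_))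
  exact (Finsupp.domCongr T.swapFun_involutive.toPerm).injective h

/-- The set is recovered as the set of ascents; exchanging the entries at each ascent sorts the
sequence. -/
theorem exists_merge_eq {x : ℕ →₀ ℕ} (hx : NearlyAntitone x) :
    ∃ p : SparseSet × (ℕ →₀ ℕ), p.1.merge p.2 = x := by
  obtain ⟨N, hN⟩ := x.support.exists_nat_subset_range
  let T : SparseSet := ⟨(Finset.range N).filter fun i => x i < x (i + 1), fun i hi hi' => by
    have h1 := (Finset.mem_filter.1 hi).2
    have h2 := (Finset.mem_filter.1 hi').2
    exact (h1.trans h2).not_ge (hx i).1⟩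
  have hT (i : ℕ) : i ∈ T.1 ↔ x i < x (i + 1) := by
    refine ⟨fun h => (Finset.mem_filter.1 h).2, fun h => Finset.mem_filter.2 ⟨?_, h⟩⟩
    have : i + 1 ∈ x.support := Finsupp.mem_support_iff.2 (by omega)
    have := Finset.mem_range.1 (hN this)
    exact Finset.mem_range.2 (by omega)
  let e := T.swapFun_involutive.toPerm
  let y : ℕ →₀ ℕ := Finsupp.equivMapDomain e x
  have hy (i : ℕ) : y i = x (T.swapFun i) := rfl
  have hlt {i : ℕ} (hi : i ∈ T.1) : y (i + 1) < y i := by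
    rw [hy, hy, swapFun_of_mem hi, swapFun_succ_of_mem hi]
    exact (hT i).1 hi
  have hanti : Antitone y := antitone_nat_of_succ_le fun i => by
    by_cases hi : i ∈ T.1
    · exact (hlt hi).le
    have hle : x (i + 1) ≤ x i := not_lt.1 fun h => hi ((hT i).2 h)
    rw [hy, hy]
    cases i with
    | zero =>
      have := hx 0
      simp only [swapFun, hi, if_false]
      split_ifs
      exacts [this.1, hle]
    | succ i =>
      have h0 := hx i
      have h1 := hx (i + 1)
      simp only [swapFun, hi, if_false]
      split_ifs
      exacts [h0.2, h1.1, h0.1, hle]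
  obtain ⟨d, hd⟩ := exists_tailSum_eq hanti
  have hTd : T.indicator ≤ d := fun i => by
    rw [indicator_apply]
    split_ifs with hi
    · have h := hlt hi
      rw [← hd, tailSum_apply d i] at h
      omega
    · exact Nat.zero_le _
  refine ⟨(T, d - T.indicator), ?_⟩
  ext i
  rw [merge_apply, tsub_add_cancel_of_le hTd, hd, hy, T.swapFun_involutive]

end SparseSet

namespace CylindricPartition

/-- The sequence `λ₁, μ₁, λ₂, μ₂, …` of the entries of the two rows `λ` and `μ`. -/
noncomputable def interleave (Λ : CylindricPartition ![2, 1]) : ℕ →₀ ℕ :=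
  Finsupp.equivMapDomain Equiv.natSumNatEquivNat ((Λ.parts 0).sumElim (Λ.parts 1))

theorem interleave_two_mul (Λ : CylindricPartition ![2, 1]) (j : ℕ) :
    Λ.interleave (2 * j) = Λ.parts 0 j := by
  have : Equiv.natSumNatEquivNat (.inl j) = 2 * j := by simp
  rw [interleave, ← this, Finsupp.equivMapDomain_apply, Equiv.symm_apply_apply]
  rfl

theorem interleave_two_mul_add_one (Λ : CylindricPartition ![2, 1]) (j : ℕ) :
    Λ.interleave (2 * j + 1) = Λ.parts 1 j := by
  have : Equiv.natSumNatEquivNat (.inr j) = 2 * j + 1 := by simp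
  rw [interleave, ← this, Finsupp.equivMapDomain_apply, Equiv.symm_apply_apply]
  rfl

theorem degree_interleave (Λ : CylindricPartition ![2, 1]) : Λ.interleave.degree = Λ.size := by
  rw [interleave, Finsupp.equivMapDomain_eq_mapDomain, Finsupp.degree_mapDomain,
    Finsupp.degree_apply]
  rw [size, Fin.sum_univ_two]
  exact Finsupp.sum_sumElim _ _ fun _ p => p

/-- Entries of the interleaved sequence at distance two lie in the same row; those at distance three
are compared by the cylindric condition. -/
theorem nearlyAntitone_interleave (Λ : CylindricPartition ![2, 1]) :
    NearlyAntitone Λ.interleave := by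
  intro n
  rcases n.even_or_odd' with ⟨j, rfl | rfl⟩
  · rw [show 2 * j + 2 = 2 * (j + 1) by ring, show 2 * j + 3 = 2 * (j + 1) + 1 by ring,
      interleave_two_mul, interleave_two_mul, interleave_two_mul_add_one]
    exact ⟨Λ.antitone 0 j.le_succ, Λ.cylindric 0 j⟩
  · rw [show 2 * j + 1 + 2 = 2 * (j + 1) + 1 by ring, show 2 * j + 1 + 3 = 2 * (j + 2) by ring,
      interleave_two_mul, interleave_two_mul_add_one, interleave_two_mul_add_one]
    exact ⟨Λ.antitone 1 j.le_succ, Λ.cylindric 1 j⟩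

theorem interleave_injective : Function.Injective interleave := by
  intro Λ M h
  ext i j
  fin_cases i
  · exact (interleave_two_mul Λ j).symm.trans (h ▸ interleave_two_mul M j)
  · exact (interleave_two_mul_add_one Λ j).symm.trans (h ▸ interleave_two_mul_add_one M j)

theorem exists_interleave_eq {x : ℕ →₀ ℕ} (hx : NearlyAntitone x) :
    ∃ Λ : CylindricPartition ![2, 1], Λ.interleave = x := by
  let Λ : CylindricPartition ![2, 1] :=
    { parts := ![x.comapDomain (2 * ·) (mul_right_injective₀ two_ne_zero).injOn,
        x.comapDomain (2 * · + 1) fun a _ b _ h => by dsimp only at h; omega]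
      antitone := fun i => by
        fin_cases i
        · exact antitone_nat_of_succ_le fun j => (hx (2 * j)).1
        · exact antitone_nat_of_succ_le fun j => (hx (2 * j + 1)).1
      cylindric := fun i j => by
        fin_cases i
        · exact (hx (2 * j)).2
        · exact (hx (2 * j + 1)).2 }
  refine ⟨Λ, ?_⟩
  ext n
  rcases n.even_or_odd' with ⟨j, rfl | rfl⟩
  · exact interleave_two_mul Λ j
  · exact interleave_two_mul_add_one Λ j

theorem bijective_interleave : Function.Bijective
    fun Λ : CylindricPartition ![2, 1] =>
      (⟨Λ.interleave, Λ.nearlyAntitone_interleave⟩ : {x : ℕ →₀ ℕ // NearlyAntitone x}) :=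
  ⟨fun _ _ h => interleave_injective (congrArg Subtype.val h), fun x =>
    (exists_interleave_eq x.2).imp fun _ h => Subtype.ext h⟩

end CylindricPartition

theorem SparseSet.bijective_merge : Function.Bijective
    fun p : SparseSet × (ℕ →₀ ℕ) =>
      (⟨p.1.merge p.2, p.1.nearlyAntitone_merge p.2⟩ : {x : ℕ →₀ ℕ // NearlyAntitone x}) :=
  ⟨fun _ _ h => merge_injective (congrArg Subtype.val h), fun x =>
    (exists_merge_eq x.2).imp fun _ h => Subtype.ext h⟩

/-- Cylindric partitions of profile `(2, 1)` correspond to pairs of a partition whose parts differ by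
at least two and an arbitrary partition. -/
theorem hasSum_pow_cylindricPartition_size {q : ℂ} (hq : ‖q‖ < 1) :
    HasSum (fun Λ : CylindricPartition ![2, 1] => q ^ Λ.size)
      ((∑' n : ℕ, q ^ n ^ 2 / qPochhammer q q n) * ∑' m : ℕ →₀ ℕ, q ^ partSize m) := by
  have hs : Summable fun p : SparseSet × (ℕ →₀ ℕ) => q ^ p.1.size * q ^ partSize p.2 :=
    summable_mul_of_summable_norm (f := fun T : SparseSet => q ^ T.size)
      (g := fun m : ℕ →₀ ℕ => q ^ partSize m) (SparseSet.summable_norm_pow_size hq)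
      (summable_norm_pow_partSize hq)
  have hprod := (SparseSet.hasSum_pow_size hq).mul
    (summable_norm_pow_partSize hq).of_norm.hasSum hs
  let e₁ := Equiv.ofBijective _ SparseSet.bijective_merge
  let e₂ := Equiv.ofBijective _ CylindricPartition.bijective_interleave
  have hx : HasSum (fun x : {x : ℕ →₀ ℕ // NearlyAntitone x} => q ^ x.1.degree)
      ((∑' n : ℕ, q ^ n ^ 2 / qPochhammer q q n) * ∑' m : ℕ →₀ ℕ, q ^ partSize m) := by
    refine e₁.hasSum_iff.1 (hprod.congr_fun fun p => ?_)
    change q ^ (p.1.merge p.2).degree = _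
    rw [SparseSet.degree_merge, add_comm, pow_add]
  refine (e₂.hasSum_iff.2 hx).congr_fun fun Λ => ?_
  change _ = q ^ Λ.interleave.degree
  rw [Λ.degree_interleave]

theorem mainTheorem1 (q : ℂ) (hq : ‖q‖ < 1) :
    Tendsto (fun n => qPochhammer (-q ^ 2) (q ^ 2) n) atTop (𝓝 (qPochhammerInf (-q ^ 2) (q ^ 2))) ∧
    Tendsto (fun n => qPochhammer q q n) atTop (𝓝 (qPochhammerInf q q)) ∧
    qPochhammerInf q q ≠ 0 ∧
    (∀ n : ℕ, qPochhammer (q ^ 4) (q ^ 4) n ≠ 0) ∧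
    Summable (fun n : ℕ => q ^ n ^ 2 / qPochhammer (q ^ 4) (q ^ 4) n) ∧
    HasSum (fun Λ : CylindricPartition ![2, 1] => q ^ Λ.size)
      ((∑' n : ℕ, q ^ n ^ 2 / qPochhammer (q ^ 4) (q ^ 4) n) *
        (qPochhammerInf (-q ^ 2) (q ^ 2) / qPochhammerInf q q)) := by
  have h4 : ‖q ^ 4‖ < 1 := norm_pow_lt_one hq four_ne_zero
  obtain ⟨hP, hlim⟩ := tsum_pow_partSize_ne_zero_and_tendsto hq
  have hneg := tendsto_qPochhammer_neg_sq hq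
  rw [qPochhammerInf_self hq, qPochhammerInf_eq hneg, div_inv_eq_mul, ← mul_assoc,
    tsum_pow_sq_div_qPochhammer_mul_eulerSeries hq]
  exact ⟨hneg, hlim, inv_ne_zero hP, qPochhammer_self_ne_zero h4,
    (summable_norm_pow_div_qPochhammer hq h4 fun n => Nat.le_self_pow two_ne_zero n).of_norm,
    hasSum_pow_cylindricPartition_size hq⟩
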